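/- Let $\mathcal X$ be a measurable space, $\mathcal Y=\{1,\dots,n\}$, and let $\mathcal H\subseteq\mathcal Y^{\mathcal X}$ be a hypothesis class. Let $\mathcal D$ be a probability distribution on $\mathcal X\times\mathcal Y$, let $\delta\in(0,1)$, and let $m,m'>0$ be integers. For $h\in\mathcal H$ and a sample $S=((x_1,y_1),\dots,(x_m,y_m))$ let $$R_{\mathcal D}(h)=\mathbb E_{(x,y)\sim\mathcal D}\,\mathbb 1[h(x)\neq y],\qquad R_S(h)=\frac1m\sum_{i=1}^m\mathbb 1[h(x_i)\neq y_i].$$ Let $\tau_{\mathcal H}(N)=\max_{((x_i,y_i))_{i\le N}}\bigl|\{(h(x_1),\dots,h(x_N)):h\in\mathcal H\}\bigr|$ be the growth function. Let $$\mathrm{Hyp}(k,m,K,M)=\sum_{j=0}^k\binom Kj\binom{M-K}{m-j}\Big/\binom Mm$$ be the hypergeometric tail (with $\binom Na=0$ for $a<0$), and for $k<m$ let $\overline{\mathrm{Hyp}}(k,m,q,M)=\min\{K\in\{0,\dots,M\}:\mathrm{Hyp}(k,m,K,M)\le q\}$ be its pseudo-inverse. Define $\eta(m)=0$ and, for $0\le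 k<m$, $$\eta(k)=\max\left\{\frac1{\sqrt{m'}},\ \frac{m+m'}{m'}\cdot\frac{u(k)-\frac km}{\sqrt{u(k)}}\right\},\qquad u(k)=\frac{\overline{\mathrm{Hyp}}\bigl(k,m,\frac{\delta}{4\tau_{\mathcal H}(m+m')},m+m'\bigr)-1}{m+m'},$$ where the quotient is read as $0$ if $k=0$ and $u(0)=0$. Assume the usual measurability of the class: every $h\in\mathcal H$ is measurable, and for every $I\subseteq\{1,\dots,m+m'\}$ the event, over samples $T\sim\mathcal D^{m+m'}$, that some $h\in\mathcal H$ misclassifies exactly the examples of $T$ with index in $I$ is measurable up to a null set. (This holds for instance for every countable class of measurable classifiers.) Then $$\Pr_{S\sim\mathcal D^m}\left[\forall h\in\mathcal H:\ R_{\mathcal D}(h)\le R_S(h)+\frac{\eta(mR_S(h))^2}{2}\left(1+\sqrt{1+\frac{4R_S(h)}{\eta(mR_S(h))^2}}\right)\right]>1-\delta,$$ where for $R_S(h)=1$, i.e. $\eta(mR_S(h))=0$, the right-hand side of the inequality in brackets is read as $R_S(h)$. Moreover the complementary event has (outer) probability less than $\delta$, so that the bound holds even as an inner probability if the event in brackets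 is not measurable. -/

import Mathlib

open MeasureTheory

noncomputable section

namespace HypTail

/-- Number of errors `m R_S(h)` of the classifier `h` on the sample `S` of size `m`. -/
def numErrors {X : Type*} {n m : ℕ} (h : X → Fin n) (S : Fin m → X × Fin n) : ℕ :=
  ∑ i, if h (S i).1 ≠ (S i).2 then 1 else 0

/-- Empirical risk `R_S(h)` for the zero-one loss. -/
def empRisk {X : Type*} {n m : ℕ} (h : X → Fin n) (S : Fin m → X × Fin n) : ℝ :=
  (1 / (m : ℝ)) * ∑ i, if h (S i).1 ≠ (S i).2 then 1 else 0

/-- `numErrors h S` is indeed `m R_S(h)`. -/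
theorem numErrors_eq {X : Type*} {n m : ℕ} (hm : 0 < m) (h : X → Fin n)
    (S : Fin m → X × Fin n) : (numErrors h S : ℝ) = m * empRisk h S := by
  have hm' : (m : ℝ) ≠ 0 := by exact_mod_cast hm.ne'
  unfold numErrors empRisk
  rw [← mul_assoc, mul_one_div_cancel hm', one_mul]
  push_cast
  rfl

/-- True risk `R_D(h)` for the zero-one loss. -/
def trueRisk {X : Type*} [MeasurableSpace X] {n : ℕ} (D : Measure (X × Fin n))
    (h : X → Fin n) : ℝ :=
  ∫ z, (if h z.1 ≠ z.2 then (1 : ℝ) else 0) ∂D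

/-- The set `{h|_S : h ∈ H}` of restrictions of the class `H` to the sample `S`. -/
def restrictions {X : Type*} {n N : ℕ} (H : Set (X → Fin n)) (S : Fin N → X × Fin n) :
    Set (Fin N → Fin n) :=
  {c | ∃ h ∈ H, c = fun i => h (S i).1}

/-- The growth function `τ_H(N)`: the largest number of restrictions of `H` to a sample of
size `N`. The supremum is over a set of naturals bounded by `n ^ N`, hence a maximum. -/
def growth {X : Type*} {n : ℕ} (H : Set (X → Fin n)) (N : ℕ) : ℕ :=
  ⨆ S : Fin N → X × Fin n, (restrictions H S).ncard

/-- Hypergeometric probability of drawing `k` successes in a sample of `m` elements from a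
population of `M` elements containing `K ≤ M` successes; it vanishes for `m < k`. -/
def hyp (k m K M : ℕ) : ℝ :=
  if k ≤ m then ((K.choose k : ℝ) * ((M - K).choose (m - k) : ℝ)) / (M.choose m : ℝ) else 0

/-- Hypergeometric tail (cumulative distribution function). -/
def hypTail (k m K M : ℕ) : ℝ :=
  ∑ j ∈ Finset.range (k + 1), hyp j m K M

/-- Pseudo-inverse of the hypergeometric tail: the least number `K ∈ {0, …, M}` of successes
with `hypTail k m K M ≤ q`. For `k < m ≤ M` and `0 ≤ q` the set contains `M`, so that this is a
minimum. -/
def hypTailInv (k m : ℕ) (q : ℝ) (M : ℕ) : ℕ :=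
  sInf {K : ℕ | K ≤ M ∧ hypTail k m K M ≤ q}

/-- `u(k)`. -/
def u {X : Type*} {n : ℕ} (H : Set (X → Fin n)) (δ : ℝ) (m m' k : ℕ) : ℝ :=
  ((hypTailInv k m (δ / (4 * (growth H (m + m') : ℝ))) (m + m') : ℝ) - 1) / ((m : ℝ) + m')

/-- `η(k)`. If `k = 0` and `u(0) = 0`, the quotient `0 / √0` is read as `0`. -/
def eta {X : Type*} {n : ℕ} (H : Set (X → Fin n)) (δ : ℝ) (m m' k : ℕ) : ℝ :=
  if k = m then 0
  else max (1 / √(m' : ℝ))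
    (((m : ℝ) + m') / m' * ((u H δ m m' k - (k : ℝ) / m) / √(u H δ m m' k)))

/-- The measurability of the class `H` that is implicit in taking the probability of events of
the form "some `h ∈ H` errs on a random sample of size `N` in such and such a way": each
classifier is measurable, and for each set `I` of indices the event that some `h ∈ H` errs on
the sample exactly at the indices in `I` is measurable up to a null set. It holds, for example,
for every countable class of measurable classifiers. -/
structure MeasurableClass {X : Type*} [MeasurableSpace X] {n : ℕ} (D : Measure (X × Fin n))
    (H : Set (X → Fin n)) (N : ℕ) : Prop where
  measurable : ∀ h ∈ H, Measurable h
  nullMeasurable_errors : ∀ I : Set (Fin N),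
    NullMeasurableSet {T : Fin N → X × Fin n | ∃ h ∈ H, ∀ i, h (T i).1 ≠ (T i).2 ↔ i ∈ I}
      (Measure.pi fun _ : Fin N => D)

end HypTail

end

open MeasureTheory

namespace HypTail

/-! The proof is a symmetrization with a ghost sample `S'` of size `m'`. Let `h` violate the bound
on `S`, with `k` errors there, empirical risk `r = k / m` and true risk `R`. The right-hand side of
the bound is the larger root of `R - r = η √R`, so a violation means `R - r > η √R`. The two terms
of the maximum defining `η` then play separate roles.

The term `1 / √m'` forces `m' R > 1`. A binomial variable of mean greater than `1` is at least its
mean with probability more than `1 / 4` (`one_fourth_lt_pi_real_mean_le`), so `h` often makes `N ≥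
m' R` errors on `S'`. The term in `u(k)` forces the pooled error count `k + N` to reach the
pseudo-inverse of the hypergeometric tail, so `k` lies in its lower `q`-tail with `q = δ / (4 τ)`,
where `τ` is the growth function at `m + m'` (`hypTail_le_of_bound_lt`).

The double sample is exchangeable, so `S` may be replaced by a uniformly random `m`-subset of it.
For one fixed error set the tail event then has probability at most `q`, and at most `τ` error sets
occur: in total at most `δ / 4` (`measure_tailEvent_le`). Fubini divides by the `1 / 4` of the ghost
sample, whose strictness makes the final bound strict (`measure_lt_of_lt_measure_section`).

The constant `1 / 4` comes from `P(Bin(n, k / n) ≤ k) ≤ 3 / 4` for `1 ≤ k < n`. At fixed mean `k`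
this probability does not increase with `n`, so the worst case is `n = k + 1`, where it equals `1 -
(1 - 1 / n) ^ n`. -/

/-! ### Hypergeometric tails as counts of subsets -/

open Finset in
theorem card_powersetCard_filter_inter_eq {M : ℕ} (I : Finset (Fin M)) {m j : ℕ} (hj : j ≤ m) :
    #{A ∈ powersetCard m (univ : Finset (Fin M)) | #(A ∩ I) = j} =
      (#I).choose j * (M - #I).choose (m - j) := by
  have hc : #Iᶜ = M - #I := by simp [card_compl]
  rw [← hc, ← card_powersetCard j I, ← card_powersetCard (m - j) Iᶜ, ← card_product]
  refine card_nbij' (fun A => (A ∩ I, A \ I)) (fun P => P.1 ∪ P.2) ?_ ?_ ?_ ?_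
  · intro A hA
    simp only [coe_filter, mem_powersetCard, Set.mem_ofPred_eq] at hA
    have := card_inter_add_card_sdiff A I
    simp only [coe_product, Set.mem_prod, mem_coe, mem_powersetCard]
    refine ⟨⟨inter_subset_right, hA.2⟩, ?_, by omega⟩
    intro x hx
    simpa using (mem_sdiff.1 hx).2
  · rintro ⟨B, C⟩ hP
    simp only [coe_product, Set.mem_prod, mem_coe, mem_powersetCard] at hP
    obtain ⟨⟨hB, hBj⟩, hC, hCj⟩ := hP
    have hd : Disjoint C I := by
      rw [disjoint_left]; intro x hx; simpa using hC hx
    have hBC : Disjoint B C := (hd.mono_right hB).symm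
    simp only [coe_filter, mem_powersetCard, Set.mem_ofPred_eq]
    refine ⟨⟨subset_univ _, by rw [card_union_of_disjoint hBC]; omega⟩, ?_⟩
    rw [union_inter_distrib_right, disjoint_iff_inter_eq_empty.1 hd, union_empty,
      inter_eq_left.2 hB, hBj]
  · intro A _
    simp only
    rw [union_comm]
    exact sdiff_union_inter A I
  · rintro ⟨B, C⟩ hP
    simp only [coe_product, Set.mem_prod, mem_coe, mem_powersetCard] at hP
    obtain ⟨⟨hB, hBj⟩, hC, hCj⟩ := hP
    have hd : Disjoint C I := by
      rw [disjoint_left]; intro x hx; simpa using hC hx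
    simp only [Prod.mk.injEq]
    constructor
    · rw [union_inter_distrib_right, disjoint_iff_inter_eq_empty.1 hd, union_empty,
        inter_eq_left.2 hB]
    · rw [union_sdiff_distrib, sdiff_eq_empty_iff_subset.2 hB, empty_union,
        sdiff_eq_self_of_disjoint hd]

open Finset in
theorem hyp_eq_card_div {M : ℕ} (I : Finset (Fin M)) (j m : ℕ) :
    hyp j m #I M =
      (#{A ∈ powersetCard m (univ : Finset (Fin M)) | #(A ∩ I) = j} : ℝ) / M.choose m := by
  unfold hyp
  split_ifs with hj
  · rw [card_powersetCard_filter_inter_eq I hj]; push_cast; rfl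
  · rw [filter_eq_empty_iff.2, card_empty]
    · simp
    · intro A hA h
      have := card_le_card (inter_subset_left (s₁ := A) (s₂ := I))
      rw [(mem_powersetCard.1 hA).2] at this
      omega

open Finset in
/-- The hypergeometric tail is the proportion of `m`-subsets meeting `I` in at most `k` points. -/
theorem hypTail_eq_card_div {M : ℕ} (I : Finset (Fin M)) (k m : ℕ) :
    hypTail k m #I M =
      (#{A ∈ powersetCard m (univ : Finset (Fin M)) | #(A ∩ I) ≤ k} : ℝ) / M.choose m := by
  unfold hypTail
  simp_rw [hyp_eq_card_div]
  rw [← sum_div, ← Nat.cast_sum]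
  congr 2
  rw [card_eq_sum_card_fiberwise (f := fun A => #(A ∩ I)) (t := range (k + 1))]
  · refine sum_congr rfl fun j hj => ?_
    rw [filter_filter]
    congr 1
    refine filter_congr fun A _ => ?_
    have := mem_range.1 hj
    omega
  · intro A hA
    simp only [coe_filter, Set.mem_ofPred_eq] at hA
    simp only [coe_range, Set.mem_Iio]
    omega

-- Realise the two populations by nested success sets `I ⊆ J`: a subset meeting `J` in at most `k`
-- points meets `I` in at most `k` points.
open Finset in
theorem hypTail_anti (k m : ℕ) {K L M : ℕ} (hKL : K ≤ L) (hL : L ≤ M) :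
    hypTail k m L M ≤ hypTail k m K M := by
  obtain ⟨J, -, hJ⟩ := exists_subset_card_eq (s := (univ : Finset (Fin M))) (n := L) (by simpa)
  obtain ⟨I, hIJ, hI⟩ := exists_subset_card_eq (s := J) (n := K) (by omega)
  rw [← hJ, ← hI, hypTail_eq_card_div, hypTail_eq_card_div]
  gcongr

theorem hypTail_self_eq_zero {k m M : ℕ} (hk : k < m) : hypTail k m M M = 0 := by
  unfold hypTail
  refine Finset.sum_eq_zero fun j hj => ?_
  have := Finset.mem_range.1 hj
  unfold hyp
  rw [if_pos (by omega), Nat.sub_self, Nat.choose_eq_zero_of_lt (show 0 < m - j by omega)]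
  simp

theorem hypTail_le_of_hypTailInv_le {k m K M : ℕ} {q : ℝ} (hq : 0 ≤ q) (hk : k < m)
    (hK : hypTailInv k m q M ≤ K) (hKM : K ≤ M) : hypTail k m K M ≤ q := by
  have hne : {K : ℕ | K ≤ M ∧ hypTail k m K M ≤ q}.Nonempty :=
    ⟨M, le_rfl, by rwa [hypTail_self_eq_zero hk]⟩
  exact (hypTail_anti k m hK hKM).trans (Nat.sInf_mem hne).2

open Finset in
/-- A distribution function evaluated at its own random variable is stochastically at least
uniform. -/
theorem card_hypTail_le {M : ℕ} (I : Finset (Fin M)) (m : ℕ) {q : ℝ} (hq : 0 ≤ q) :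
    (#{A ∈ powersetCard m (univ : Finset (Fin M)) | hypTail #(A ∩ I) m #I M ≤ q} : ℝ) ≤
      q * M.choose m := by
  set B := {A ∈ powersetCard m (univ : Finset (Fin M)) | hypTail #(A ∩ I) m #I M ≤ q}
  rcases B.eq_empty_or_nonempty with hB | hB
  · rw [hB]; simp only [card_empty, Nat.cast_zero]; positivity
  -- The member `A` with the largest intersection carries the whole of `B`: every other member is
  -- counted by the tail evaluated at `#(A ∩ I)`, which is at most `q`.
  obtain ⟨A, hA, hmax⟩ := exists_max_image B (fun A => #(A ∩ I)) hB
  obtain ⟨hAm, hAq⟩ := mem_filter.1 hA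
  have hpos : (0 : ℝ) < M.choose m := by
    have := card_pos.2 ⟨A, hAm⟩
    rw [card_powersetCard, card_univ, Fintype.card_fin] at this
    exact_mod_cast this
  rw [hypTail_eq_card_div, div_le_iff₀ hpos] at hAq
  refine le_trans ?_ hAq
  gcongr
  intro C hC
  exact mem_filter.2 ⟨(mem_filter.1 hC).1, hmax C hC⟩

/-! ### Binomial variables and their mean -/

open Polynomial

theorem bernsteinPolynomial_succ_succ (n j : ℕ) :
    bernsteinPolynomial ℝ (n + 1) (j + 1) =
      (1 - X) * bernsteinPolynomial ℝ n (j + 1) + X * bernsteinPolynomial ℝ n j := by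
  unfold bernsteinPolynomial
  rw [Nat.choose_succ_succ, Nat.add_sub_add_right]
  rcases lt_or_ge n (j + 1) with h | h
  · rw [Nat.choose_eq_zero_of_lt h]; push_cast; ring
  · obtain ⟨d, rfl⟩ := Nat.exists_eq_add_of_le h
    rw [show j + 1 + d - j = d + 1 by omega, show j + 1 + d - (j + 1) = d by omega]
    push_cast
    ring

theorem bernsteinPolynomial_eval_nonneg (n j : ℕ) {p : ℝ} (h0 : 0 ≤ p) (h1 : p ≤ 1) :
    0 ≤ (bernsteinPolynomial ℝ n j).eval p := by
  have : 0 ≤ 1 - p := by linarith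
  simp only [bernsteinPolynomial, eval_mul, eval_natCast, eval_pow, eval_X, eval_sub, eval_one]
  positivity

/-- The binomial probabilities decrease beyond the mode. -/
theorem bernsteinPolynomial_eval_succ_le {l j : ℕ} {p : ℝ} (h0 : 0 ≤ p) (h1 : p ≤ 1)
    (h : (l + 1) * p ≤ j + 1) :
    (bernsteinPolynomial ℝ l (j + 1)).eval p ≤ (bernsteinPolynomial ℝ l j).eval p := by
  rcases lt_or_ge l (j + 1) with hl | hl
  · rw [bernsteinPolynomial.eq_zero_of_lt ℝ hl, eval_zero]
    exact bernsteinPolynomial_eval_nonneg l j h0 h1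
  obtain ⟨d, rfl⟩ := Nat.exists_eq_add_of_le hl
  have hq : 0 ≤ 1 - p := by linarith
  have hc : ((j + 1 + d).choose (j + 1) : ℝ) * (j + 1) = (j + 1 + d).choose j * (d + 1) := by
    have := Nat.choose_succ_right_eq (j + 1 + d) j
    rw [show j + 1 + d - j = d + 1 by omega] at this
    exact_mod_cast this
  simp only [bernsteinPolynomial, eval_mul, eval_natCast, eval_pow, eval_X, eval_sub, eval_one]
  rw [show j + 1 + d - j = d + 1 by omega, show j + 1 + d - (j + 1) = d by omega]
  have hj : (0 : ℝ) < j + 1 := by positivity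
  refine le_of_mul_le_mul_left ?_ hj
  push_cast at h
  calc ((j : ℝ) + 1) * ((j + 1 + d).choose (j + 1) * p ^ (j + 1) * (1 - p) ^ d)
      = ((j + 1 + d).choose j * (p ^ j * (1 - p) ^ d)) * ((d + 1) * p) := by
        rw [show ((j : ℝ) + 1) * ((j + 1 + d).choose (j + 1) * p ^ (j + 1) * (1 - p) ^ d) =
          ((j + 1 + d).choose (j + 1) * (j + 1)) * (p ^ (j + 1) * (1 - p) ^ d) by ring, hc]
        ring
    _ ≤ ((j + 1 + d).choose j * (p ^ j * (1 - p) ^ d)) * ((j + 1) * (1 - p)) := by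
        exact mul_le_mul_of_nonneg_left (by linarith) (by positivity)
    _ = _ := by ring

/-- The binomial distribution function `P(Bin(n, p) ≤ k)` as a polynomial in `p`. -/
noncomputable def binomialCdf (n k : ℕ) : ℝ[X] :=
  ∑ j ∈ Finset.range (k + 1), bernsteinPolynomial ℝ n j

theorem binomialCdf_succ_right (n k : ℕ) :
    binomialCdf n (k + 1) = binomialCdf n k + bernsteinPolynomial ℝ n (k + 1) :=
  Finset.sum_range_succ _ _

theorem derivative_binomialCdf (n k : ℕ) :
    derivative (binomialCdf n k) = -n * bernsteinPolynomial ℝ (n - 1) k := by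
  induction k with
  | zero => simp [binomialCdf, bernsteinPolynomial.derivative_zero]
  | succ k ih =>
    rw [binomialCdf_succ_right, derivative_add, ih, bernsteinPolynomial.derivative_succ]
    ring

theorem binomialCdf_succ_left (n k : ℕ) :
    binomialCdf (n + 1) k = binomialCdf n k - X * bernsteinPolynomial ℝ n k := by
  induction k with
  | zero => simp [binomialCdf, bernsteinPolynomial, pow_succ]; ring
  | succ k ih =>
    rw [binomialCdf_succ_right, ih, bernsteinPolynomial_succ_succ, binomialCdf_succ_right]
    ring

/-- Interpolation at constant mean `j + 1`: `F b` is the probability that `Bin(l + 1, a) +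
Bernoulli(b) ≤ j + 1` with the two independent and `a = (j + 1 - b) / (l + 1)`. Its derivative is `b
- a` times the difference of the `Bin(l, a)` probabilities at `j` and `j + 1`. -/
theorem binomialCdf_succ_le (l j : ℕ) (hjl : j ≤ l) :
    (binomialCdf (l + 2) (j + 1)).eval ((j + 1 : ℝ) / (l + 2)) ≤
      (binomialCdf (l + 1) (j + 1)).eval ((j + 1 : ℝ) / (l + 1)) := by
  set F : ℝ → ℝ := fun b =>
    (binomialCdf (l + 1) (j + 1)).eval ((j + 1 - b) / (l + 1)) -
      b * (bernsteinPolynomial ℝ (l + 1) (j + 1)).eval ((j + 1 - b) / (l + 1)) with hF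
  have hl : (0 : ℝ) < l + 1 := by positivity
  have hl2 : (0 : ℝ) < l + 2 := by positivity
  have hjl' : (j : ℝ) ≤ l := by exact_mod_cast hjl
  have hder : ∀ b : ℝ, HasDerivAt F ((b - (j + 1 - b) / (l + 1)) *
      ((bernsteinPolynomial ℝ l j).eval ((j + 1 - b) / (l + 1)) -
        (bernsteinPolynomial ℝ l (j + 1)).eval ((j + 1 - b) / (l + 1)))) b := by
    intro b
    have ha : HasDerivAt (fun b : ℝ => (j + 1 - b) / (l + 1)) (-1 / (l + 1) : ℝ) b :=
      ((hasDerivAt_id b).const_sub _).div_const _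
    have h1 := ((binomialCdf (l + 1) (j + 1)).hasDerivAt ((j + 1 - b) / (l + 1))).comp b ha
    have h2 := ((bernsteinPolynomial ℝ (l + 1) (j + 1)).hasDerivAt
      ((j + 1 - b) / (l + 1))).comp b ha
    have h3 := h1.sub ((hasDerivAt_id b).mul h2)
    refine h3.congr_deriv ?_
    simp only [Function.comp_apply, id]
    rw [derivative_binomialCdf, bernsteinPolynomial.derivative_succ,
      bernsteinPolynomial_succ_succ]
    simp only [Nat.add_sub_cancel, eval_mul, eval_neg, eval_natCast, eval_sub, eval_add, eval_X,
      eval_one]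
    push_cast
    field_simp
    ring
  have hb : (j + 1 : ℝ) / (l + 2) ≤ 1 := by rw [div_le_one hl2]; linarith
  have hb0 : (0 : ℝ) ≤ (j + 1 : ℝ) / (l + 2) := by positivity
  have hanti : AntitoneOn F (Set.Icc 0 ((j + 1 : ℝ) / (l + 2))) := by
    refine antitoneOn_of_deriv_nonpos (convex_Icc _ _)
      (fun b _ => (hder b).continuousAt.continuousWithinAt)
      (fun b _ => (hder b).differentiableAt.differentiableWithinAt) fun b hb' => ?_
    rw [interior_Icc] at hb'
    rw [(hder b).deriv]
    have hb2 := hb'.2.le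
    rw [le_div_iff₀ hl2] at hb2
    -- Up to the right endpoint `b ≤ a`, and `(l + 1) a = j + 1 - b ≤ j + 1` puts `j` where the
    -- binomial probabilities no longer increase.
    refine mul_nonpos_of_nonpos_of_nonneg ?_ ?_
    · rw [sub_nonpos, le_div_iff₀ hl]; linarith
    · rw [sub_nonneg]
      apply bernsteinPolynomial_eval_succ_le
      · apply div_nonneg _ hl.le; linarith [hb'.2]
      · rw [div_le_one hl]; linarith [hb'.1]
      · rw [mul_div_cancel₀ _ hl.ne']; linarith [hb'.1]
  have := hanti (Set.left_mem_Icc.2 hb0) (Set.right_mem_Icc.2 hb0) hb0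
  -- At the right endpoint `a = b`, so the sum is a genuine `Bin(l + 2, b)`.
  have e : ((j : ℝ) + 1 - (j + 1) / (l + 2)) / (l + 1) = (j + 1) / (l + 2) := by
    field_simp; ring
  simp only [hF, e, sub_zero, zero_mul] at this
  rwa [binomialCdf_succ_left, eval_sub, eval_mul, eval_X]

/-- Bernoulli's inequality with exponent `n / 2 ≥ 1` gives `1 / 2`; then square. -/
theorem one_fourth_le_one_sub_inv_pow {n : ℕ} (hn : 2 ≤ n) :
    (1 / 4 : ℝ) ≤ (1 - 1 / (n : ℝ)) ^ n := by
  have hn' : (2 : ℝ) ≤ n := by exact_mod_cast hn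
  have hs : (-1 : ℝ) ≤ -(1 / n) := by
    rw [neg_le_neg_iff, div_le_one (by linarith)]; linarith
  have h := one_add_mul_self_le_rpow_one_add hs (p := (n : ℝ) / 2) (by linarith)
  have h0 : (0 : ℝ) ≤ 1 + -(1 / (n : ℝ)) := by linarith
  have e : (1 : ℝ) + n / 2 * -(1 / n) = 1 / 2 := by
    field_simp; ring
  rw [e] at h
  have h2 : ((1 + -(1 / (n : ℝ))) ^ ((n : ℝ) / 2)) ^ 2 = (1 - 1 / (n : ℝ)) ^ n := by
    rw [← Real.rpow_natCast, ← Real.rpow_mul h0, ← Real.rpow_natCast]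
    congr 1
    push_cast
    ring
  rw [← h2]
  nlinarith

theorem binomialCdf_self (n : ℕ) : binomialCdf n n = 1 :=
  bernsteinPolynomial.sum ℝ n

/-- A binomial variable with integral mean `k` satisfies `P(Bin(n, k / n) ≤ k) ≤ 3 / 4`. -/
theorem binomialCdf_eval_mean_le (j d : ℕ) :
    (binomialCdf (j + 2 + d) (j + 1)).eval ((j + 1 : ℝ) / (j + 2 + d)) ≤ 3 / 4 := by
  induction d with
  | zero =>
    have h1 := binomialCdf_self (j + 2)
    rw [binomialCdf_succ_right (j + 2) (j + 1)] at h1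
    have h2 := congrArg (eval ((j + 1 : ℝ) / (j + 2))) h1
    have h3 := one_fourth_le_one_sub_inv_pow (n := j + 2) (by omega)
    have e : (1 : ℝ) - 1 / ((j + 2 : ℕ) : ℝ) = (j + 1) / (j + 2) := by
      push_cast; field_simp; ring
    rw [e] at h3
    simp only [bernsteinPolynomial, eval_add, eval_one, eval_pow, eval_X,
      Nat.choose_self, Nat.cast_one, one_mul, Nat.sub_self, pow_zero, mul_one] at h2
    simp only [Nat.cast_zero, add_zero]
    linarith
  | succ d ih =>
    have h := binomialCdf_succ_le (j + 1 + d) j (by omega)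
    push_cast at h ih ⊢
    rw [show j + 2 + (d + 1) = j + 1 + d + 2 by ring,
      show (j : ℝ) + 2 + (d + 1) = j + 1 + d + 2 by ring]
    refine h.trans ?_
    rw [show j + 1 + d + 1 = j + 2 + d by ring, show (j : ℝ) + 1 + d + 1 = j + 2 + d by ring]
    exact ih

theorem binomialCdf_strictAntiOn {n k : ℕ} (hk : k < n) :
    StrictAntiOn (fun p : ℝ => (binomialCdf n k).eval p) (Set.Icc 0 1) := by
  refine strictAntiOn_of_deriv_neg (convex_Icc _ _) (binomialCdf n k).continuousOn
    fun p hp => ?_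
  rw [interior_Icc] at hp
  rw [Polynomial.deriv, derivative_binomialCdf]
  have h0 : 0 < p := hp.1
  have h1 : 0 < 1 - p := by linarith [hp.2]
  have hn : (0 : ℝ) < n := by exact_mod_cast (by omega : 0 < n)
  have hc : (0 : ℝ) < (n - 1).choose k := by
    exact_mod_cast Nat.choose_pos (by omega)
  have : 0 < (n : ℝ) * ((n - 1).choose k * p ^ k * (1 - p) ^ (n - 1 - k)) := by positivity
  simp only [bernsteinPolynomial, eval_mul, eval_natCast, eval_pow, eval_X, eval_sub, eval_one,
    eval_neg]
  linarith

/-- If `1 ≤ k < n p` then `P(Bin(n, p) ≤ k) < 3 / 4`. -/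
theorem binomialCdf_eval_lt {n k : ℕ} {p : ℝ} (hk : 1 ≤ k) (hkp : (k : ℝ) < n * p) (hp : p ≤ 1) :
    (binomialCdf n k).eval p < 3 / 4 := by
  have hkn : k < n := by
    have : (k : ℝ) < n := hkp.trans_le (mul_le_of_le_one_right (by positivity) hp)
    exact_mod_cast this
  obtain ⟨j, rfl⟩ := Nat.exists_eq_add_of_le' hk
  obtain ⟨d, rfl⟩ := Nat.exists_eq_add_of_le (show j + 2 ≤ n by omega)
  have hle := binomialCdf_eval_mean_le j d
  have hlt : ((j : ℝ) + 1) / (j + 2 + d) < p := by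
    push_cast at hkp
    rw [div_lt_iff₀ (by positivity)]; linarith
  have h0 : (0 : ℝ) ≤ ((j : ℝ) + 1) / (j + 2 + d) := by positivity
  exact (binomialCdf_strictAntiOn hkn ⟨h0, (hlt.trans_le hp).le⟩
    ⟨h0.trans hlt.le, hp⟩ hlt).trans_le hle

/-! ### Deterministic consequences of a violated bound -/

theorem sub_div_sqrt_mono {r x y : ℝ} (hr : 0 ≤ r) (hx : 0 < x) (hxy : x ≤ y) :
    (x - r) / √x ≤ (y - r) / √y := by
  have hy : 0 < y := hx.trans_le hxy
  have ha : 0 < √x := Real.sqrt_pos.2 hx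
  have hab : √x ≤ √y := Real.sqrt_le_sqrt hxy
  have hb : 0 < √y := Real.sqrt_pos.2 hy
  rw [div_le_div_iff₀ ha hb]
  have h1 : √x ^ 2 = x := Real.sq_sqrt hx.le
  have h2 : √y ^ 2 = y := Real.sq_sqrt hy.le
  have h3 : 0 ≤ (√y - √x) * (√x * √y + r) :=
    mul_nonneg (by linarith) (by positivity)
  have e : (y - r) * √x - (x - r) * √y = (√y - √x) * (√x * √y + r) := by
    calc (y - r) * √x - (x - r) * √y = (√y ^ 2 - r) * √x - (√x ^ 2 - r) * √y := by rw [h1, h2]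
      _ = _ := by ring
  linarith

/-- The bound is the larger root of `R - r = η √R`, solved for `R`. -/
theorem mul_sqrt_lt_of_bound_lt {r R η : ℝ} (hr : 0 ≤ r) (hR : 0 ≤ R) (hη : 0 < η)
    (h : r + η ^ 2 / 2 * (1 + √(1 + 4 * r / η ^ 2)) < R) : η * √R < R - r := by
  by_contra! hle
  set s := √R
  set w := √(1 + 4 * r / η ^ 2)
  have hs : s ^ 2 = R := Real.sq_sqrt hR
  have hw : w ^ 2 = 1 + 4 * r / η ^ 2 := Real.sq_sqrt (by positivity)
  have hw0 : 0 ≤ w := Real.sqrt_nonneg _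
  have hηw : (η * w) ^ 2 = η ^ 2 + 4 * r := by
    rw [mul_pow, hw]; field_simp
  have h1 : 2 * s - η ≤ η * w := by
    -- Completing the square in `s ^ 2 - r ≤ η s` gives `(2 s - η) ^ 2 ≤ η ^ 2 + 4 r`.
    apply le_of_sq_le_sq _ (by positivity)
    rw [hηw]; nlinarith
  nlinarith

/-- Since `R - r ≤ R`, the deviation gives `η < √R`, hence `1 / √m' < √R`. This is what the first
term of `η` is for. -/
theorem one_lt_mul_of_inv_sqrt_le {r R η : ℝ} {m' : ℕ} (hm' : 0 < m') (hr : 0 ≤ r)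
    (hη : 1 / √(m' : ℝ) ≤ η) (h : η * √R < R - r) : 1 < m' * R := by
  have hm : (0 : ℝ) < m' := by exact_mod_cast hm'
  have hsm : 0 < √(m' : ℝ) := Real.sqrt_pos.2 hm
  have hη0 : 0 < η := lt_of_lt_of_le (by positivity) hη
  have hR : 0 < R := by
    have := mul_nonneg hη0.le (Real.sqrt_nonneg R)
    linarith
  have hs : 0 < √R := Real.sqrt_pos.2 hR
  have hsR : √R * √R = R := Real.mul_self_sqrt hR.le
  have hsM : √(m' : ℝ) * √(m' : ℝ) = m' := Real.mul_self_sqrt hm.le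
  have h1 : 1 / √(m' : ℝ) < √R := by
    refine lt_of_mul_lt_mul_right ?_ hs.le
    calc 1 / √(m' : ℝ) * √R ≤ η * √R := by gcongr
      _ < √R * √R := by linarith
  rw [div_lt_iff₀ hsm] at h1
  calc (1 : ℝ) < (√R * √(m' : ℝ)) * (√R * √(m' : ℝ)) := by nlinarith
    _ = (√(m' : ℝ) * √(m' : ℝ)) * (√R * √R) := by ring
    _ = m' * R := by rw [hsR, hsM]

/-- If the pooled risk `x ≥ (m r + m' R) / (m + m')` is at most `v`, then the relative deviation
`(R - r) / √R` is controlled by that of `v`. -/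
theorem sub_le_of_pooled_le {r R x v a b : ℝ} (ha : 0 < a) (hb : 0 < b) (hr : 0 ≤ r)
    (hrR : r < R) (hx : (a * r + b * R) / (a + b) ≤ x) (hxv : x ≤ v) :
    R - r ≤ (a + b) / b * ((v - r) / √v) * √R := by
  have hR : 0 < R := hr.trans_lt hrR
  set y := (a * r + b * R) / (a + b)
  have hy : 0 < y := by positivity
  have hyR : y ≤ R := by
    rw [div_le_iff₀ (by positivity)]; nlinarith
  have hyr : y - r = b * (R - r) / (a + b) := by
    simp only [y]; field_simp; ring
  have hsy : 0 < √y := Real.sqrt_pos.2 hy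
  have hsR : 0 < √R := Real.sqrt_pos.2 hR
  have h1 : (y - r) / √R ≤ (v - r) / √v := by
    refine le_trans ?_ (sub_div_sqrt_mono hr hy (hx.trans hxv))
    have : 0 ≤ y - r := by rw [hyr]; apply div_nonneg _ (by positivity); nlinarith
    gcongr
  calc R - r = (a + b) / b * ((y - r) / √R) * √R := by
        rw [hyr]; field_simp
    _ ≤ _ := by gcongr

theorem numErrors_le {X : Type*} {n m : ℕ} (h : X → Fin n) (S : Fin m → X × Fin n) :
    numErrors h S ≤ m := by
  unfold numErrors
  calc _ ≤ ∑ _i : Fin m, 1 := Finset.sum_le_sum fun i _ => by split_ifs <;> simp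
    _ = m := by simp

/-- If `h` violates the risk bound on `S` and errs at least as often as expected on the ghost
sample `S'`, then the number of errors on `S` lies in the lower hypergeometric tail. -/
theorem hypTail_le_of_bound_lt {X : Type*} {n m m' : ℕ} (H : Set (X → Fin n)) {δ R : ℝ}
    (hδ : 0 < δ) (hm : 0 < m) (hm' : 0 < m') (h : X → Fin n) (S : Fin m → X × Fin n)
    (hR0 : 0 ≤ R) (hR1 : R ≤ 1)
    (hlt : empRisk h S + eta H δ m m' (numErrors h S) ^ 2 / 2 *
      (1 + √(1 + 4 * empRisk h S / eta H δ m m' (numErrors h S) ^ 2)) < R) :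
    1 < m' * R ∧ ∀ N : ℕ, N ≤ m' → m' * R ≤ N →
      hypTail (numErrors h S) m (numErrors h S + N) (m + m') ≤
        δ / (4 * (growth H (m + m') : ℝ)) := by
  have hmR : (0 : ℝ) < m := by exact_mod_cast hm
  have hmR' : (0 : ℝ) < m' := by exact_mod_cast hm'
  have hk := numErrors_eq hm h S
  have hkm := numErrors_le h S
  set r := empRisk h S
  set k := numErrors h S
  have hr : r = k / m := by rw [hk]; field_simp
  have hr0 : 0 ≤ r := by rw [hr]; positivity
  -- If every example is misclassified then `r = 1` and `η = 0`, so a violation would mean `R > 1`.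
  rcases hkm.eq_or_lt with hkm | hkm
  · exfalso
    rw [hkm, eta, if_pos rfl] at hlt
    rw [hkm, div_self hmR.ne'] at hr
    simp only [ne_eq, OfNat.ofNat_ne_zero, not_false_eq_true, zero_pow, zero_div, zero_mul,
      add_zero] at hlt
    linarith
  have hη : eta H δ m m' k = max (1 / √(m' : ℝ))
    (((m : ℝ) + m') / m' * ((u H δ m m' k - (k : ℝ) / m) / √(u H δ m m' k))) := if_neg hkm.ne
  set η := eta H δ m m' k
  have hη1 : 1 / √(m' : ℝ) ≤ η := hη ▸ le_max_left _ _
  have hη2 : ((m : ℝ) + m') / m' * ((u H δ m m' k - r) / √(u H δ m m' k)) ≤ η := by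
    rw [hr, hη]; exact le_max_right _ _
  have hη0 : 0 < η := lt_of_lt_of_le (by positivity) hη1
  have hdev := mul_sqrt_lt_of_bound_lt hr0 hR0 hη0 hlt
  refine ⟨one_lt_mul_of_inv_sqrt_le hm' hr0 hη1 hdev, fun N hN hRN => ?_⟩
  refine hypTail_le_of_hypTailInv_le (by positivity) hkm ?_ (by omega)
  -- Otherwise `k + N` is at most the pseudo-inverse minus one, which is why `u` carries the `-1`:
  -- the pooled risk is at most `u(k)`, and monotonicity yields `R - r ≤ η √R`.
  by_contra! hK
  have hM : (0 : ℝ) < m + m' := by positivity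
  have hK' : ((k + N : ℕ) : ℝ) + 1 ≤
      hypTailInv k m (δ / (4 * (growth H (m + m') : ℝ))) (m + m') := by exact_mod_cast hK
  have hrR : r < R := by
    have := mul_nonneg hη0.le (Real.sqrt_nonneg R)
    linarith
  have h1 := sub_le_of_pooled_le (x := ((k + N : ℕ) : ℝ) / (m + m')) (v := u H δ m m' k)
    hmR hmR' hr0 hrR (by rw [← hk]; push_cast; gcongr) (by unfold u; gcongr; linarith)
  have h2 := mul_le_mul_of_nonneg_right hη2 (Real.sqrt_nonneg R)
  linarith

/-! ### Error counts under the product measure -/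

open Polynomial in
theorem pi_real_card_le {Z : Type*} [MeasurableSpace Z] (D : Measure Z) [IsProbabilityMeasure D]
    {E : Set Z} (hE : MeasurableSet E) [DecidablePred (· ∈ E)] (m k : ℕ) :
    (Measure.pi fun _ : Fin m => D).real {z | (Finset.univ.filter fun i => z i ∈ E).card ≤ k} ≤
      (binomialCdf m k).eval (D.real E) := by
  classical
  set 𝒥 := (Finset.univ : Finset (Finset (Fin m))).filter (·.card ≤ k)
  have hsub : {z : Fin m → Z | (Finset.univ.filter fun i => z i ∈ E).card ≤ k} ⊆
      ⋃ J ∈ 𝒥, Set.univ.pi (fun i => if i ∈ J then E else Eᶜ) := by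
    intro z hz
    refine Set.mem_biUnion (x := Finset.univ.filter fun i => z i ∈ E)
      (by simpa [𝒥] using hz) fun i _ => ?_
    by_cases hi : z i ∈ E <;> simp [hi]
  have hbox : ∀ J : Finset (Fin m), (Measure.pi fun _ : Fin m => D).real
      (Set.univ.pi (fun i => if i ∈ J then E else Eᶜ)) =
        D.real E ^ J.card * (1 - D.real E) ^ (m - J.card) := by
    intro J
    rw [Measure.real, Measure.pi_pi, ENNReal.toReal_prod,
      ← Finset.prod_mul_prod_compl J]
    congr 1
    · rw [Finset.prod_congr rfl (g := fun _ => D.real E), Finset.prod_const]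
      intro i hi; rw [if_pos hi]; rfl
    · rw [Finset.prod_congr rfl (g := fun _ => 1 - D.real E), Finset.prod_const,
        Finset.card_compl, Fintype.card_fin]
      intro i hi
      rw [if_neg (Finset.mem_compl.1 hi), ← probReal_compl_eq_one_sub hE]; rfl
  calc _ ≤ _ := measureReal_mono hsub (measure_ne_top _ _)
    _ ≤ _ := measureReal_biUnion_finset_le _ _
    _ = ∑ J ∈ 𝒥, D.real E ^ J.card * (1 - D.real E) ^ (m - J.card) :=
        Finset.sum_congr rfl fun J _ => hbox J
    _ = _ := by
      rw [← Finset.sum_fiberwise_of_maps_to (g := Finset.card) (t := Finset.range (k + 1))]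
      · rw [binomialCdf, eval_finsetSum]
        refine Finset.sum_congr rfl fun j hj => ?_
        have hj := Finset.mem_range.1 hj
        have : 𝒥.filter (·.card = j) = Finset.powersetCard j Finset.univ := by
          ext J
          simp only [𝒥, Finset.filter_filter, Finset.mem_filter, Finset.mem_univ, true_and,
            Finset.mem_powersetCard, Finset.subset_univ]
          omega
        rw [this, Finset.sum_congr rfl (g := fun _ => D.real E ^ j * (1 - D.real E) ^ (m - j)),
          Finset.sum_const, Finset.card_powersetCard, Finset.card_univ, Fintype.card_fin]
        · simp [bernsteinPolynomial, mul_assoc]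
        · intro J hJ; rw [(Finset.mem_powersetCard.1 hJ).2]
      · intro J hJ
        have := (Finset.mem_filter.1 hJ).2
        exact Finset.mem_coe.2 (Finset.mem_range.2 (by omega))

/-- A binomial variable with success probability above `1 / m` is at least its mean with
probability more than `1 / 4`. -/
theorem one_fourth_lt_pi_real_mean_le {Z : Type*} [MeasurableSpace Z] (D : Measure Z)
    [IsProbabilityMeasure D] {E : Set Z} (hE : MeasurableSet E) [DecidablePred (· ∈ E)] {m : ℕ}
    (hp : 1 < m * D.real E) :
    1 / 4 < (Measure.pi fun _ : Fin m => D).real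
      {z | m * D.real E ≤ (Finset.univ.filter fun i => z i ∈ E).card} := by
  -- With `k + 1` the ceiling of the mean, a count fails to reach the mean exactly when it is at
  -- most `k`; a mean above `1` makes `k ≥ 1`.
  obtain ⟨k, hk⟩ : ∃ k, ⌈m * D.real E⌉₊ = k + 1 :=
    Nat.exists_eq_succ_of_ne_zero (Nat.ceil_pos.2 (by linarith)).ne'
  have hk1 : 1 ≤ k := by
    have : 1 < ⌈m * D.real E⌉₊ := Nat.lt_ceil.2 (by exact_mod_cast hp)
    omega
  have hkp : (k : ℝ) < m * D.real E := Nat.lt_ceil.1 (by omega)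
  have h1 := (pi_real_card_le D hE m k).trans_lt
    (binomialCdf_eval_lt hk1 hkp measureReal_le_one)
  set A := {z : Fin m → Z | (Finset.univ.filter fun i => z i ∈ E).card ≤ k}
  have h2 : (Measure.pi fun _ : Fin m => D).real Aᶜ ≤ (Measure.pi fun _ : Fin m => D).real
      {z | m * D.real E ≤ (Finset.univ.filter fun i => z i ∈ E).card} := by
    refine measureReal_mono fun z hz => ?_
    have hz : k < (Finset.univ.filter fun i => z i ∈ E).card := not_le.1 hz
    exact Nat.ceil_le.1 (hk.trans_le hz)
  have h3 := measureReal_union_le (μ := Measure.pi fun _ : Fin m => D) A Aᶜ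
  rw [Set.union_compl_self, probReal_univ] at h3
  linarith

/-! ### Concatenating and permuting samples -/

theorem measurePreserving_append {Z : Type*} [MeasurableSpace Z] (D : Measure Z)
    [IsProbabilityMeasure D] (m m' : ℕ) :
    MeasurePreserving (fun P : (Fin m → Z) × (Fin m' → Z) => Fin.append P.1 P.2)
      ((Measure.pi fun _ : Fin m => D).prod (Measure.pi fun _ : Fin m' => D))
      (Measure.pi fun _ : Fin (m + m') => D) := by
  have hmeas : Measurable (fun P : (Fin m → Z) × (Fin m' → Z) => Fin.append P.1 P.2) := by
    refine measurable_pi_iff.2 fun i => ?_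
    refine Fin.addCases (fun i => ?_) (fun i => ?_) i
    · simp only [Fin.append_left]; fun_prop
    · simp only [Fin.append_right]; fun_prop
  refine ⟨hmeas, (Measure.pi_eq fun s hs => ?_).symm⟩
  rw [Measure.map_apply hmeas (MeasurableSet.univ_pi hs), Fin.prod_univ_add]
  have : (fun P : (Fin m → Z) × (Fin m' → Z) => Fin.append P.1 P.2) ⁻¹' (Set.univ.pi s) =
      (Set.univ.pi fun i => s (Fin.castAdd m' i)) ×ˢ (Set.univ.pi fun i => s (Fin.natAdd m i)) := by
    ext P
    simp only [Set.mem_preimage, Set.mem_univ_pi, Set.mem_prod]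
    constructor
    · intro h
      exact ⟨fun i => by simpa using h (Fin.castAdd m' i), fun i => by simpa using h (Fin.natAdd m i)⟩
    · rintro ⟨h1, h2⟩ i
      refine Fin.addCases (fun i => ?_) (fun i => ?_) i
      · simpa using h1 i
      · simpa using h2 i
  rw [this, Measure.prod_prod, Measure.pi_pi, Measure.pi_pi]

theorem measurePreserving_comp_perm {Z : Type*} [MeasurableSpace Z] (D : Measure Z)
    [IsProbabilityMeasure D] {M : ℕ} (σ : Equiv.Perm (Fin M)) :
    MeasurePreserving (fun T : Fin M → Z => T ∘ σ)
      (Measure.pi fun _ : Fin M => D) (Measure.pi fun _ : Fin M => D) := by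
  have hmeas : Measurable (fun T : Fin M → Z => T ∘ σ) :=
    measurable_pi_iff.2 fun i => measurable_pi_apply (σ i)
  refine ⟨hmeas, (Measure.pi_eq fun s hs => ?_).symm⟩
  rw [Measure.map_apply hmeas (MeasurableSet.univ_pi hs)]
  have : (fun T : Fin M → Z => T ∘ σ) ⁻¹' (Set.univ.pi s) =
      Set.univ.pi fun i => s (σ.symm i) := by
    ext T
    simp only [Set.mem_preimage, Set.mem_univ_pi, Function.comp_apply]
    exact ⟨fun h i => by simpa using h (σ.symm i), fun h i => by simpa using h (σ i)⟩
  rw [this, Measure.pi_pi]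
  exact Equiv.prod_comp σ.symm fun i => D (s i)

theorem exists_perm_map_eq {M : ℕ} {A B : Finset (Fin M)} (h : A.card = B.card) :
    ∃ σ : Equiv.Perm (Fin M), A.map σ.toEmbedding = B := by
  have e : {x // x ∈ A} ≃ {x // x ∈ B} := Fintype.equivOfCardEq (by simpa using h)
  refine ⟨e.extendSubtype, Finset.eq_of_subset_of_card_le ?_ (by simp [h])⟩
  intro x hx
  obtain ⟨y, hy, rfl⟩ := Finset.mem_map.1 hx
  exact e.extendSubtype_mem y hy

/-! ### Error sets and the tail event on the double sample -/

/-- The set of indices at which `h` errs on the sample `T`. -/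
def errorSet {X : Type*} {n M : ℕ} (h : X → Fin n) (T : Fin M → X × Fin n) : Finset (Fin M) :=
  Finset.univ.filter fun i => h (T i).1 ≠ (T i).2

theorem card_errorSet {X : Type*} {n M : ℕ} (h : X → Fin n) (T : Fin M → X × Fin n) :
    (errorSet h T).card = numErrors h T :=
  Finset.card_filter _ _

theorem map_errorSet_comp {X : Type*} {n M : ℕ} (h : X → Fin n) (T : Fin M → X × Fin n)
    (σ : Equiv.Perm (Fin M)) : (errorSet h (T ∘ σ)).map σ.toEmbedding = errorSet h T := by
  ext i
  simp only [errorSet, Finset.mem_map_equiv, Finset.mem_filter, Finset.mem_univ, true_and,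
    Function.comp_apply, Equiv.apply_symm_apply]

theorem card_errorSet_append_inter {X : Type*} {n m m' : ℕ} (h : X → Fin n)
    (S : Fin m → X × Fin n) (S' : Fin m' → X × Fin n) :
    (errorSet h (Fin.append S S') ∩ Finset.univ.map (Fin.castAddEmb m')).card = numErrors h S := by
  rw [← card_errorSet, ← Finset.card_map (Fin.castAddEmb m' : Fin m ↪ _)]
  refine congrArg Finset.card ?_
  ext i
  simp only [errorSet, Finset.mem_inter, Finset.mem_filter, Finset.mem_map, Finset.mem_univ,
    true_and]
  constructor
  · rintro ⟨h1, a, rfl⟩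
    exact ⟨a, by simpa using h1, rfl⟩
  · rintro ⟨a, ha, rfl⟩
    exact ⟨by simpa using ha, a, rfl⟩

theorem numErrors_append {X : Type*} {n m m' : ℕ} (h : X → Fin n)
    (S : Fin m → X × Fin n) (S' : Fin m' → X × Fin n) :
    numErrors h (Fin.append S S') = numErrors h S + numErrors h S' := by
  simp [numErrors, Fin.sum_univ_add]

theorem ncard_restrictions_le_growth {X : Type*} {n N : ℕ} (H : Set (X → Fin n))
    (S : Fin N → X × Fin n) : (restrictions H S).ncard ≤ growth H N := by
  refine le_ciSup (f := fun S : Fin N → X × Fin n => (restrictions H S).ncard)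
    ⟨(Set.univ : Set (Fin N → Fin n)).ncard, ?_⟩ S
  rintro _ ⟨S, rfl⟩
  exact Set.ncard_le_ncard (Set.subset_univ _)

-- For fixed `T` the labels are fixed, so the error set of `h` is a function of its restriction to
-- `T`.
open Classical in
theorem card_errorSets_le_growth {X : Type*} {n M : ℕ} (H : Set (X → Fin n))
    (T : Fin M → X × Fin n) :
    (Finset.univ.filter fun I => ∃ h ∈ H, errorSet h T = I).card ≤ growth H M := by
  refine le_trans ?_ (ncard_restrictions_le_growth H T)
  rw [← Set.ncard_coe_finset]
  refine le_trans (Set.ncard_le_ncard (t := (fun c : Fin M → Fin n =>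
    Finset.univ.filter fun i => c i ≠ (T i).2) '' restrictions H T) ?_)
    (Set.ncard_image_le (Set.toFinite _))
  intro I hI
  obtain ⟨h, hH, rfl⟩ := (Finset.mem_filter.1 hI).2
  exact ⟨_, ⟨h, hH, rfl⟩, rfl⟩

/-- The event that the number of errors of some classifier within the index set `A` lies in the
lower `q`-tail of the hypergeometric distribution. -/
def tailEvent {X : Type*} {n M : ℕ} (H : Set (X → Fin n)) (m : ℕ) (q : ℝ) (A : Finset (Fin M)) :
    Set (Fin M → X × Fin n) :=
  {T | ∃ h ∈ H, hypTail (errorSet h T ∩ A).card m (errorSet h T).card M ≤ q}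

theorem nullMeasurableSet_tailEvent {X : Type*} [MeasurableSpace X] {n M : ℕ}
    {H : Set (X → Fin n)} {D : Measure (X × Fin n)} (hH : MeasurableClass D H M) (m : ℕ) (q : ℝ)
    (A : Finset (Fin M)) :
    NullMeasurableSet (tailEvent H m q A) (Measure.pi fun _ : Fin M => D) := by
  have : tailEvent H m q A =
      ⋃ I ∈ {I : Finset (Fin M) | hypTail (I ∩ A).card m I.card M ≤ q},
        {T : Fin M → X × Fin n | ∃ h ∈ H, ∀ i, h (T i).1 ≠ (T i).2 ↔ i ∈ (I : Set (Fin M))} := by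
    ext T
    simp only [tailEvent, Set.mem_iUnion, Set.mem_ofPred_eq, exists_prop, Finset.mem_coe]
    constructor
    · rintro ⟨h, hh, hq⟩
      exact ⟨_, hq, h, hh, fun i => by simp [errorSet]⟩
    · rintro ⟨I, hq, h, hh, hI⟩
      have : errorSet h T = I := by ext i; simpa [errorSet] using hI i
      exact ⟨h, hh, by rwa [this]⟩
  rw [this]
  exact NullMeasurableSet.biUnion (Set.to_countable _) fun I _ => hH.nullMeasurable_errors I

/-- Exchangeability: a permutation of the indices carrying `A` to `B` preserves the product measure
and the sizes of all error sets. -/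
theorem measure_tailEvent_eq {X : Type*} [MeasurableSpace X] {n M : ℕ} {H : Set (X → Fin n)}
    {D : Measure (X × Fin n)} [IsProbabilityMeasure D] (hH : MeasurableClass D H M) (m : ℕ) (q : ℝ)
    {A B : Finset (Fin M)} (hAB : A.card = B.card) :
    (Measure.pi fun _ : Fin M => D) (tailEvent H m q A) =
      (Measure.pi fun _ : Fin M => D) (tailEvent H m q B) := by
  obtain ⟨σ, rfl⟩ := exists_perm_map_eq hAB
  rw [← (measurePreserving_comp_perm D σ).measure_preimage (nullMeasurableSet_tailEvent hH m q A)]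
  congr 1
  ext T
  have hcard : ∀ h : X → Fin n, (errorSet h (T ∘ σ)).card = (errorSet h T).card := fun h => by
    rw [← map_errorSet_comp h T σ, Finset.card_map]
  have hinter : ∀ h : X → Fin n, (errorSet h (T ∘ σ) ∩ A).card =
      (errorSet h T ∩ A.map σ.toEmbedding).card := fun h => by
    rw [← map_errorSet_comp h T σ, ← Finset.map_inter, Finset.card_map]
  simp only [tailEvent, Set.mem_preimage, Set.mem_ofPred_eq, hcard, hinter]

-- A union bound over the error sets realised on the fixed sample `T`, the randomness being now in
-- the choice of `A`.
open Classical in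
theorem card_mem_tailEvent_le {X : Type*} {n M : ℕ} (H : Set (X → Fin n)) (m : ℕ) {q : ℝ}
    (hq : 0 ≤ q) (T : Fin M → X × Fin n) :
    (((Finset.powersetCard m (Finset.univ : Finset (Fin M))).filter
      fun A => T ∈ tailEvent H m q A).card : ℝ) ≤ growth H M * q * M.choose m := by
  set 𝓘 := Finset.univ.filter fun I => ∃ h ∈ H, errorSet h T = I with h𝓘
  have hsub : (Finset.powersetCard m (Finset.univ : Finset (Fin M))).filter
      (fun A => T ∈ tailEvent H m q A) ⊆ 𝓘.biUnion fun I =>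
        (Finset.powersetCard m (Finset.univ : Finset (Fin M))).filter
          fun A => hypTail (A ∩ I).card m I.card M ≤ q := by
    intro A hA
    obtain ⟨hAm, h, hh, hle⟩ := Finset.mem_filter.1 hA
    refine Finset.mem_biUnion.2 ⟨errorSet h T, ?_, Finset.mem_filter.2 ⟨hAm, ?_⟩⟩
    · exact Finset.mem_filter.2 ⟨Finset.mem_univ _, h, hh, rfl⟩
    · rwa [Finset.inter_comm]
  calc _ ≤ ((𝓘.biUnion fun I =>
        (Finset.powersetCard m (Finset.univ : Finset (Fin M))).filter
          fun A => hypTail (A ∩ I).card m I.card M ≤ q).card : ℝ) := by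
        exact_mod_cast Finset.card_le_card hsub
    _ ≤ ∑ I ∈ 𝓘, (((Finset.powersetCard m (Finset.univ : Finset (Fin M))).filter
          fun A => hypTail (A ∩ I).card m I.card M ≤ q).card : ℝ) := by
        exact_mod_cast Finset.card_biUnion_le
    _ ≤ ∑ I ∈ 𝓘, q * M.choose m := by
        gcongr with I
        convert card_hypTail_le I m hq
    _ = 𝓘.card * (q * M.choose m) := by rw [Finset.sum_const, nsmul_eq_mul]
    _ ≤ growth H M * (q * M.choose m) := by
        gcongr
        exact card_errorSets_le_growth H T
    _ = _ := by ring

/-- All `m`-subsets give the same probability, so it equals the average over them; exchanging sum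
and integral reduces the claim to a count for each fixed `T`. -/
theorem measure_tailEvent_le {X : Type*} [MeasurableSpace X] {n M m : ℕ} {H : Set (X → Fin n)}
    {D : Measure (X × Fin n)} [IsProbabilityMeasure D] (hH : MeasurableClass D H M) {q : ℝ}
    (hq : 0 ≤ q) {A : Finset (Fin M)} (hA : A.card = m) :
    (Measure.pi fun _ : Fin M => D) (tailEvent H m q A) ≤ ENNReal.ofReal (growth H M * q) := by
  classical
  set μ := Measure.pi fun _ : Fin M => D
  set 𝒜 := Finset.powersetCard m (Finset.univ : Finset (Fin M))
  have hcard : 𝒜.card = M.choose m := by simp [𝒜]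
  have hpos : 0 < M.choose m := by
    rw [← hcard]; exact Finset.card_pos.2 ⟨A, by simp [𝒜, hA]⟩
  have key : (M.choose m : ENNReal) * μ (tailEvent H m q A) ≤
      M.choose m * ENNReal.ofReal (growth H M * q) := by
    calc (M.choose m : ENNReal) * μ (tailEvent H m q A)
        = ∑ B ∈ 𝒜, μ (tailEvent H m q B) := by
          rw [Finset.sum_congr rfl (g := fun _ => μ (tailEvent H m q A)), Finset.sum_const, hcard,
            nsmul_eq_mul]
          intro B hB
          exact measure_tailEvent_eq hH m q (by rw [(Finset.mem_powersetCard.1 hB).2, hA])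
      _ = ∑ B ∈ 𝒜, ∫⁻ T, (tailEvent H m q B).indicator 1 T ∂μ := by
          refine Finset.sum_congr rfl fun B _ => ?_
          rw [lintegral_indicator_one₀ (nullMeasurableSet_tailEvent hH m q B)]
      _ = ∫⁻ T, ∑ B ∈ 𝒜, (tailEvent H m q B).indicator 1 T ∂μ := by
          rw [lintegral_finsetSum' _ fun B _ => ?_]
          exact (aemeasurable_indicator_const_iff 1).2 (nullMeasurableSet_tailEvent hH m q B)
      _ ≤ ∫⁻ _, ENNReal.ofReal (growth H M * q * M.choose m) ∂μ := by
          refine lintegral_mono fun T => ?_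
          simp only [Set.indicator_apply, Pi.one_apply]
          rw [Finset.sum_boole, ← ENNReal.ofReal_natCast]
          exact ENNReal.ofReal_le_ofReal (card_mem_tailEvent_le H m hq T)
      _ = M.choose m * ENNReal.ofReal (growth H M * q) := by
          rw [lintegral_const, measure_univ, mul_one, mul_comm _ (M.choose m : ℝ),
            ENNReal.ofReal_mul (by positivity), ENNReal.ofReal_natCast]
  exact (ENNReal.mul_le_mul_iff_right (by exact_mod_cast hpos.ne') (by simp)).1 key

/-! ### From the double sample back to a single one -/

theorem measurableSet_error {X : Type*} [MeasurableSpace X] {n : ℕ} {h : X → Fin n}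
    (hh : Measurable h) : MeasurableSet {z : X × Fin n | h z.1 ≠ z.2} :=
  (measurableSet_eq_fun (hh.comp measurable_fst) measurable_snd).compl

theorem trueRisk_eq {X : Type*} [MeasurableSpace X] {n : ℕ} (D : Measure (X × Fin n))
    {h : X → Fin n} (hh : Measurable h) :
    trueRisk D h = D.real {z : X × Fin n | h z.1 ≠ z.2} := by
  rw [← integral_indicator_one (measurableSet_error hh)]
  unfold trueRisk
  congr 1 with z
  simp [Set.indicator_apply]

/-- A set all of whose sections have measure more than `c` in some set of small product measure is
itself small. -/
theorem measure_lt_of_lt_measure_section {α β : Type*} [MeasurableSpace α] [MeasurableSpace β]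
    (μ : Measure α) (ν : Measure β) [IsProbabilityMeasure μ] [IsProbabilityMeasure ν]
    {B : Set α} {G : Set (α × β)} {c b : ENNReal} (hb : 0 < b) (hc : c ≠ 0)
    (hB : ∀ x ∈ B, c < ν (Prod.mk x ⁻¹' G)) (hG : μ.prod ν G ≤ c * b) : μ B < b := by
  -- Neither `B` nor `G` need be measurable. A measurable hull of `G` has the same measure and
  -- larger sections, and its superlevel set `t` is a measurable superset of `B`.
  set G₀ := toMeasurable (μ.prod ν) G
  have hG₀ : MeasurableSet G₀ := measurableSet_toMeasurable _ _
  have hmeas : Measurable fun x => ν (Prod.mk x ⁻¹' G₀) := measurable_measure_prodMk_left hG₀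
  set t := {x | c < ν (Prod.mk x ⁻¹' G₀)}
  have ht : MeasurableSet t := measurableSet_lt measurable_const hmeas
  have hBt : B ⊆ t := fun x hx =>
    (hB x hx).trans_le (measure_mono (Set.preimage_mono (subset_toMeasurable _ _)))
  refine (measure_mono hBt).trans_lt ?_
  rcases eq_or_ne (μ t) 0 with h0 | h0
  · rwa [h0]
  have hc' : c ≠ ⊤ := by
    obtain ⟨x, hx⟩ := nonempty_of_measure_ne_zero h0
    exact (lt_of_lt_of_le hx le_top).ne
  have h1 : ∫⁻ _ in t, c ∂μ < ∫⁻ x in t, ν (Prod.mk x ⁻¹' G₀) ∂μ :=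
    setLIntegral_strict_mono ht h0 hmeas
      (by rw [setLIntegral_const]; exact ENNReal.mul_ne_top hc' (measure_ne_top _ _))
      (Filter.Eventually.of_forall fun x hx => hx)
  rw [setLIntegral_const] at h1
  have h2 : c * μ t < c * b := by
    calc c * μ t < ∫⁻ x in t, ν (Prod.mk x ⁻¹' G₀) ∂μ := h1
      _ ≤ ∫⁻ x, ν (Prod.mk x ⁻¹' G₀) ∂μ := setLIntegral_le_lintegral _ _
      _ = μ.prod ν G₀ := (Measure.prod_apply hG₀).symm
      _ = μ.prod ν G := measure_toMeasurable _
      _ ≤ c * b := hG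
  exact (ENNReal.mul_lt_mul_iff_right hc hc').1 h2

end HypTail

theorem corollary1 {X : Type*} [MeasurableSpace X] {n : ℕ} (H : Set (X → Fin n))
    (D : Measure (X × Fin n)) [IsProbabilityMeasure D]
    (δ : ℝ) (hδ0 : 0 < δ) (hδ1 : δ < 1) (m m' : ℕ) (hm : 0 < m) (hm' : 0 < m')
    (hH : HypTail.MeasurableClass D H (m + m')) :
    1 - δ < (Measure.pi fun _ : Fin m => D).real
        {S | ∀ h ∈ H, HypTail.trueRisk D h ≤ HypTail.empRisk h S +
          HypTail.eta H δ m m' (HypTail.numErrors h S) ^ 2 / 2 *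
            (1 + √(1 + 4 * HypTail.empRisk h S /
              HypTail.eta H δ m m' (HypTail.numErrors h S) ^ 2))} ∧
      (Measure.pi fun _ : Fin m => D).real
        {S | ∀ h ∈ H, HypTail.trueRisk D h ≤ HypTail.empRisk h S +
          HypTail.eta H δ m m' (HypTail.numErrors h S) ^ 2 / 2 *
            (1 + √(1 + 4 * HypTail.empRisk h S /
              HypTail.eta H δ m m' (HypTail.numErrors h S) ^ 2))}ᶜ < δ := by
  set A := {S : Fin m → X × Fin n | ∀ h ∈ H, HypTail.trueRisk D h ≤ HypTail.empRisk h S +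
          HypTail.eta H δ m m' (HypTail.numErrors h S) ^ 2 / 2 *
            (1 + √(1 + 4 * HypTail.empRisk h S /
              HypTail.eta H δ m m' (HypTail.numErrors h S) ^ 2))} with hA
  suffices hcompl : (Measure.pi fun _ : Fin m => D).real Aᶜ < δ by
    refine ⟨?_, hcompl⟩
    have h := measureReal_union_le (μ := Measure.pi fun _ : Fin m => D) A Aᶜ
    rw [Set.union_compl_self, probReal_univ] at h
    linarith
  set q := δ / (4 * (HypTail.growth H (m + m') : ℝ)) with hq
  have hq0 : 0 ≤ q := by positivity
  have hτ : HypTail.growth H (m + m') * q ≤ 1 / 4 * δ := by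
    -- If the growth function vanishes, the division by zero makes `q = 0`, and the product is still
    -- small enough.
    rcases eq_or_ne (HypTail.growth H (m + m') : ℝ) 0 with h0 | h0
    · rw [h0, zero_mul]; positivity
    · rw [hq]; field_simp; exact le_rfl
  have hpre := HypTail.measurePreserving_append D m m'
  have hG := HypTail.measure_tailEvent_le hH (m := m) hq0
    (A := Finset.univ.map (Fin.castAddEmb m')) (by simp)
  rw [← hpre.measure_preimage (HypTail.nullMeasurableSet_tailEvent hH m q _)] at hG
  have hG' := hG.trans (ENNReal.ofReal_le_ofReal hτ)
  rw [ENNReal.ofReal_mul (by norm_num)] at hG'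
  have hlt := HypTail.measure_lt_of_lt_measure_section (Measure.pi fun _ : Fin m => D)
    (Measure.pi fun _ : Fin m' => D) (B := Aᶜ) (ENNReal.ofReal_pos.2 hδ0)
    (by simp) ?_ hG'
  · exact (ENNReal.lt_ofReal_iff_toReal_lt (measure_ne_top _ _)).1 hlt
  intro S hS
  simp only [hA, Set.mem_compl_iff, Set.mem_ofPred_eq, not_forall, not_le] at hS
  -- The violating `h` depends on `S` alone, so it is fixed when `S'` is drawn and the binomial
  -- estimate applies to its error event.
  obtain ⟨h, hh, hS⟩ := hS
  have hR := HypTail.trueRisk_eq D (hH.measurable h hh)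
  obtain ⟨h1, h2⟩ := HypTail.hypTail_le_of_bound_lt H hδ0 hm hm' h S
    (hR ▸ measureReal_nonneg) (hR ▸ measureReal_le_one) hS
  rw [hR] at h1 h2
  have h3 := HypTail.one_fourth_lt_pi_real_mean_le D
    (HypTail.measurableSet_error (hH.measurable h hh)) h1
  rw [ENNReal.ofReal_lt_iff_lt_toReal (by norm_num) (measure_ne_top _ _)]
  refine h3.trans_le (measureReal_mono fun S' hS' => ?_)
  refine ⟨h, hh, ?_⟩
  rw [HypTail.card_errorSet_append_inter, HypTail.card_errorSet, HypTail.numErrors_append]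
  refine h2 _ (HypTail.numErrors_le h S') ?_
  rw [← HypTail.card_errorSet]
  exact hS'
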